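/- Consider the simply typed $\lambda$-calculus (typing à la Church, terms up to $\alpha$-conversion) with a single ground type $\circ$ and a finite set of constants, all of type $\circ$. All terms are assumed to be in $\eta$-long form: every subterm that is not in function position in an application is of type $\circ$ or is an abstraction ($\beta$-redexes are allowed). The notation $\lambda y_1\dots y_n.u$ implies that $u$ has type $\circ$. Two closed terms $t,t'$ of the same type are *observationally equivalent*, $t\equiv t'$, if either they have type $\circ$ and $t=_\beta t'$, or they have a type $A\to B$ and $(t\,a)\equiv(t'\,a)$ for every closed term $a:A$. A *cell* is a context of type $\circ$ of the form $\Sigma[\ ]_1\dots[\ ]_K=(y\,(C_1[\ ]_1\dots[\ ]_K)\dots(C_p[\ ]_1\dots[\ ]_K))$ with $K,p\ge 0$, where $y$ is a variable, all holes $[\ ]_k$ have type $\circ$, and each $C_i[\ ]_1\dots[\ ]_K$ is a context without free variables whose holes are amongst $[\ ]_1,\dots,[\ ]_K$; holes are filled without capture of variables. The *cellular* terms are defined inductively: a term is cellular if it is of the form - $\lambda y_1\dots y_n.a$ with $a$ a constant, or - $\lambda y_1\dots y_n.\Sigma[w_1]_1\dots[w_K]_K$ where $\Sigma$ is a cell whose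 free variable is amongst $y_1,\dots,y_n$ and each $\lambda y_1\dots y_n.w_j$ is a cellular term. **Theorem.** Every closed term $t$ is observationally equivalent to a cellular term. -/

import Mathlib

namespace STLC

universe u

/-- Simple types over a single ground type. -/
inductive Ty : Type
  | ground : Ty
  | arr : Ty → Ty → Ty

/-- `Var Γ A`: the variables of type `A` declared in the context `Γ` (typed de Bruijn indices). -/
inductive Var : List Ty → Ty → Type
  | here {Γ : List Ty} {A : Ty} : Var (A :: Γ) A
  | there {Γ : List Ty} {A B : Ty} : Var Γ A → Var (B :: Γ) A

/-- `Tm C Γ A`: the simply typed λ-terms (up to α-conversion) of type `A` with free variables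
declared in `Γ`, over the set `C` of constants, all of which have ground type.
In `lam`, the head of the extended context is the variable that is abstracted. -/
inductive Tm (C : Type u) : List Ty → Ty → Type u
  | const {Γ : List Ty} (c : C) : Tm C Γ Ty.ground
  | var {Γ : List Ty} {A : Ty} (x : Var Γ A) : Tm C Γ A
  | app {Γ : List Ty} {A B : Ty} (f : Tm C Γ (Ty.arr A B)) (a : Tm C Γ A) : Tm C Γ B
  | lam {Γ : List Ty} {A B : Ty} (b : Tm C (A :: Γ) B) : Tm C Γ (Ty.arr A B)

/-- Closed terms. -/
abbrev Closed (C : Type u) (A : Ty) : Type u := Tm C [] A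

/-! ### Renaming and capture-avoiding simultaneous substitution -/

/-- Type-preserving renamings of the variables of `Γ` by variables of `Δ`. -/
abbrev Ren (Γ Δ : List Ty) : Type := ∀ A : Ty, Var Γ A → Var Δ A

/-- Type-preserving substitutions of terms over `Δ` for the variables of `Γ`. -/
abbrev Sub (C : Type u) (Γ Δ : List Ty) : Type u := ∀ A : Ty, Var Γ A → Tm C Δ A

/-- Extension of a renaming below a binder. -/
def Ren.lift {Γ Δ : List Ty} {B : Ty} (ρ : Ren Γ Δ) : Ren (B :: Γ) (B :: Δ)
  | _, Var.here => Var.here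
  | _, Var.there x => Var.there (ρ _ x)

def Tm.rename {C : Type u} : {Γ Δ : List Ty} → {A : Ty} → Ren Γ Δ → Tm C Γ A → Tm C Δ A
  | _, _, _, _, Tm.const c => Tm.const c
  | _, _, _, ρ, Tm.var x => Tm.var (ρ _ x)
  | _, _, _, ρ, Tm.app f a => Tm.app (f.rename ρ) (a.rename ρ)
  | _, _, _, ρ, Tm.lam b => Tm.lam (b.rename ρ.lift)

/-- Extension of a substitution below a binder. -/
def Sub.lift {C : Type u} {Γ Δ : List Ty} {B : Ty} (σ : Sub C Γ Δ) : Sub C (B :: Γ) (B :: Δ)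
  | _, Var.here => Tm.var Var.here
  | _, Var.there x => (σ _ x).rename (fun _ y => Var.there y)

def Tm.subst {C : Type u} : {Γ Δ : List Ty} → {A : Ty} → Sub C Γ Δ → Tm C Γ A → Tm C Δ A
  | _, _, _, _, Tm.const c => Tm.const c
  | _, _, _, σ, Tm.var x => σ _ x
  | _, _, _, σ, Tm.app f a => Tm.app (f.subst σ) (a.subst σ)
  | _, _, _, σ, Tm.lam b => Tm.lam (b.subst σ.lift)

/-- The substitution of `a` for the most recently bound variable. -/
def Sub.single {C : Type u} {Γ : List Ty} {B : Ty} (a : Tm C Γ B) : Sub C (B :: Γ) Γ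
  | _, Var.here => a
  | _, Var.there x => Tm.var x

/-! ### β-equality -/

/-- One step of β-reduction, at any position in a term. -/
inductive Beta {C : Type u} : {Γ : List Ty} → {A : Ty} → Tm C Γ A → Tm C Γ A → Prop
  | beta {Γ : List Ty} {A B : Ty} (b : Tm C (A :: Γ) B) (a : Tm C Γ A) :
      Beta (Tm.app (Tm.lam b) a) (b.subst (Sub.single a))
  | appL {Γ : List Ty} {A B : Ty} {f g : Tm C Γ (Ty.arr A B)} (a : Tm C Γ A) :
      Beta f g → Beta (Tm.app f a) (Tm.app g a)
  | appR {Γ : List Ty} {A B : Ty} (f : Tm C Γ (Ty.arr A B)) {a b : Tm C Γ A} :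
      Beta a b → Beta (Tm.app f a) (Tm.app f b)
  | lam {Γ : List Ty} {A B : Ty} {b d : Tm C (A :: Γ) B} :
      Beta b d → Beta (Tm.lam b) (Tm.lam d)

/-- β-equality: the equivalence relation generated by β-reduction. -/
def BetaEq {C : Type u} {Γ : List Ty} {A : Ty} (t s : Tm C Γ A) : Prop :=
  Relation.EqvGen Beta t s

/-! ### η-long forms -/

/-- The term has ground type or is an abstraction. -/
def Tm.Expanded {C : Type u} : {Γ : List Ty} → {A : Ty} → Tm C Γ A → Prop
  | _, _, Tm.const _ => True
  | _, A, Tm.var _ => A = Ty.ground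
  | _, B, Tm.app _ _ => B = Ty.ground
  | _, _, Tm.lam _ => True

/-- Every proper subterm that is not in function position in an application has ground type or
is an abstraction. -/
def Tm.EtaLongInside {C : Type u} : {Γ : List Ty} → {A : Ty} → Tm C Γ A → Prop
  | _, _, Tm.const _ => True
  | _, _, Tm.var _ => True
  | _, _, Tm.app f a => f.EtaLongInside ∧ a.EtaLongInside ∧ a.Expanded
  | _, _, Tm.lam b => b.EtaLongInside ∧ b.Expanded

/-- η-long terms (β-redexes are allowed): every subterm, including the term itself, that is not in
function position in an application has ground type or is an abstraction. -/
def Tm.EtaLong {C : Type u} {Γ : List Ty} {A : Ty} (t : Tm C Γ A) : Prop :=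
  t.EtaLongInside ∧ t.Expanded

/-! ### Observational equivalence -/

/-- Observational equivalence of closed terms of the same type, by recursion on the type:
β-equality at the ground type; at a type `A → B`, application to an arbitrary closed η-long
term of type `A` gives observationally equivalent terms of type `B`. -/
def ObsEq {C : Type u} : {A : Ty} → Closed C A → Closed C A → Prop
  | Ty.ground, t, s => BetaEq t s
  | Ty.arr A _, t, s => ∀ a : Closed C A, a.EtaLong → ObsEq (Tm.app t a) (Tm.app s a)

/-! ### Cells and cellular terms -/

/-- `K` holes of ground type. -/
abbrev holes (K : ℕ) : List Ty := List.replicate K Ty.ground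

/-- An (η-long) context of type `A` with holes amongst `K` holes of ground type and with no free
variables. The holes are represented by variables of ground type, and these are the only
variables that may occur free; the holes are to be filled by capture-avoiding substitution. -/
structure ClosedContext (C : Type u) (K : ℕ) (A : Ty) : Type u where
  body : Tm C (holes K) A
  etaLong : body.EtaLong

/-- The substitution that fills the `j`-th hole with `w j`. -/
def fillSub {C : Type u} {Δ : List Ty} :
    (K : ℕ) → (Fin K → Tm C Δ Ty.ground) → Sub C (holes K) Δ
  | _ + 1, w, _, Var.here => w 0
  | K + 1, w, _, Var.there x => fillSub K (fun j => w j.succ) _ x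

/-- `E[w 0] … [w (K - 1)]`. -/
def ClosedContext.fill {C : Type u} {K : ℕ} {A : Ty} {Δ : List Ty} (E : ClosedContext C K A)
    (w : Fin K → Tm C Δ Ty.ground) : Tm C Δ A :=
  E.body.subst (fillSub K w)

/-- A full list `E₁, …, Eₚ` of arguments for a head of type `A = A₁ → ⋯ → Aₚ → ground`, where each
`Eᵢ` is a context of type `Aᵢ` with no free variables. -/
inductive CellArgs (C : Type u) (K : ℕ) : Ty → Type u
  | nil : CellArgs C K Ty.ground
  | cons {A B : Ty} (E : ClosedContext C K A) (Es : CellArgs C K B) : CellArgs C K (Ty.arr A B)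

/-- Application of a head `h` to the filled arguments: `h (E₁[w]) … (Eₚ[w])`. -/
def CellArgs.applyTo {C : Type u} {K : ℕ} {Δ : List Ty} (w : Fin K → Tm C Δ Ty.ground) :
    {A : Ty} → CellArgs C K A → Tm C Δ A → Tm C Δ Ty.ground
  | _, CellArgs.nil, h => h
  | _, CellArgs.cons E Es, h => Es.applyTo w (Tm.app h (E.fill w))

/-- A cell `y E₁ … Eₚ` (of ground type, with `K` holes of ground type) whose unique free variable
`y` is amongst the variables of `Δ`. -/
structure Cell (C : Type u) (Δ : List Ty) (K : ℕ) : Type u where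
  headType : Ty
  head : Var Δ headType
  args : CellArgs C K headType

/-- `S[w 0] … [w (K - 1)]` for a cell `S`. -/
def Cell.fill {C : Type u} {Δ : List Ty} {K : ℕ} (S : Cell C Δ K)
    (w : Fin K → Tm C Δ Ty.ground) : Tm C Δ Ty.ground :=
  S.args.applyTo w (Tm.var S.head)

/-- `CellularBody u`, for a term `u` of ground type with free variables amongst `Δ = y₁, …, yₙ`:
the term `λ y₁ … yₙ. u` is cellular, that is, `u` is a constant, or `u = S[w₁] … [w_K]` where `S`
is a cell whose free variable is amongst `y₁, …, yₙ` and each `λ y₁ … yₙ. wⱼ` is cellular. -/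
inductive CellularBody {C : Type u} {Δ : List Ty} : Tm C Δ Ty.ground → Prop
  | const (c : C) : CellularBody (Tm.const c)
  | cell {K : ℕ} (S : Cell C Δ K) (w : Fin K → Tm C Δ Ty.ground)
      (hw : ∀ j, CellularBody (w j)) : CellularBody (S.fill w)

/-- The term is `λ y₁ … yₙ. u` with `u` of ground type and `CellularBody u`, where the cells in `u`
may be headed by `y₁, …, yₙ` and by the variables of `Γ` (the variables already abstracted). -/
inductive CellularUnder {C : Type u} : {Γ : List Ty} → {A : Ty} → Tm C Γ A → Prop
  | body {Γ : List Ty} {u : Tm C Γ Ty.ground} : CellularBody u → CellularUnder u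
  | lam {Γ : List Ty} {A B : Ty} {b : Tm C (A :: Γ) B} :
      CellularUnder b → CellularUnder (Tm.lam b)

/-- Cellular terms. -/
def Cellular {C : Type u} {A : Ty} (t : Closed C A) : Prop := CellularUnder t

end STLC

namespace STLC

universe u

variable {C : Type u}

/-! ### The algebra of renaming and substitution -/

/-! Terms are read in the full function hierarchy over the constants. A closed ground term is
β-equal to the constant that is its value (`Tm.computes_value`), so observational equivalence
follows from `Agree`, the equality of results on all closed arguments. Closed functions respect
`Agree` (`Agree.app_congr`), and `Tm.exists_normal` reduces the problem to η-long normal forms.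

Consider an application `x a₁ … aₚ` in a normal form, its arguments already abstractions of trees of
cells. It fails to be a cell filled with cellular bodies only because some `aᵢ` may contain a cell Σ
headed by an outer variable, below which local variables of `aᵢ` occur. Write the application as
F[Σ[w₁]…[w_K]], with no other outer cell above Σ inside `aᵢ`. The key identity is

F[Σ[w₁]…[w_K]] ≡ F[Σ[F[w₁]]…[F[w_K]]].

On the right, the filled Σ no longer depends on local variables, so it may serve as a leaf. Under a
closed substitution, Σ is constant or a projection as a function of its holes
(`CellArgs.constant_or_projection`), and F, as a function of the abstracted subtree, is constant or
sends every constant function to its value (`Tm.constant_or_curry_const`); the identity holds in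
each case. Each F[wₖ], and F around the new leaf, has fewer outer cells, so induction on their
number applies (`TreeArgs.exists_cellularBody`). Without outer cells, the leaves become the hole
fillings of a single cell (`TreeArgs.exists_cellArgs`). -/

theorem Ren.lift_comp {Γ Δ Θ : List Ty} {B : Ty} (ρ : Ren Γ Δ) (ρ' : Ren Δ Θ) :
    (fun A x => (Ren.lift ρ' : Ren (B :: Δ) (B :: Θ)) A (ρ.lift A x)) =
      Ren.lift (fun A x => ρ' A (ρ A x)) := by
  funext A x; cases x <;> rfl

theorem Tm.rename_rename {Γ Δ Θ : List Ty} {A : Ty} (t : Tm C Γ A) (ρ : Ren Γ Δ) (ρ' : Ren Δ Θ) :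
    (t.rename ρ).rename ρ' = t.rename (fun A x => ρ' A (ρ A x)) := by
  induction t generalizing Δ Θ with
  | const c => rfl
  | var x => rfl
  | app f a ihf iha => simp only [Tm.rename, ihf, iha]
  | lam b ih => simp only [Tm.rename, ih, Ren.lift_comp]

theorem Tm.subst_rename {Γ Δ Θ : List Ty} {A : Ty} (t : Tm C Γ A) (ρ : Ren Γ Δ) (σ : Sub C Δ Θ) :
    (t.rename ρ).subst σ = t.subst (fun A x => σ A (ρ A x)) := by
  induction t generalizing Δ Θ with
  | const c => rfl
  | var x => rfl
  | app f a ihf iha => simp only [Tm.rename, Tm.subst, ihf, iha]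
  | lam b ih =>
    simp only [Tm.rename, Tm.subst, ih]
    congr 2
    funext A x; cases x <;> rfl

theorem Tm.rename_subst {Γ Δ Θ : List Ty} {A : Ty} (t : Tm C Γ A) (σ : Sub C Γ Δ) (ρ : Ren Δ Θ) :
    (t.subst σ).rename ρ = t.subst (fun A x => (σ A x).rename ρ) := by
  induction t generalizing Δ Θ with
  | const c => rfl
  | var x => rfl
  | app f a ihf iha => simp only [Tm.rename, Tm.subst, ihf, iha]
  | lam b ih =>
    simp only [Tm.rename, Tm.subst, ih]
    congr 2
    funext A x
    cases x with
    | here => rfl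
    | there x =>
      simp only [Sub.lift, Tm.rename_rename]
      rfl

theorem Tm.subst_subst {Γ Δ Θ : List Ty} {A : Ty} (t : Tm C Γ A) (σ : Sub C Γ Δ)
    (τ : Sub C Δ Θ) :
    (t.subst σ).subst τ = t.subst (fun A x => (σ A x).subst τ) := by
  induction t generalizing Δ Θ with
  | const c => rfl
  | var x => rfl
  | app f a ihf iha => simp only [Tm.subst, ihf, iha]
  | lam b ih =>
    simp only [Tm.subst, ih]
    congr 2
    funext A x
    cases x with
    | here => rfl
    | there x =>
      simp only [Sub.lift, Tm.subst_rename, Tm.rename_subst]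

theorem Tm.subst_var {Γ : List Ty} {A : Ty} (t : Tm C Γ A) :
    t.subst (fun _ x => Tm.var x) = t := by
  induction t with
  | const c => rfl
  | var x => rfl
  | app f a ihf iha => simp only [Tm.subst, ihf, iha]
  | lam b ih =>
    simp only [Tm.subst]
    congr 1
    refine Eq.trans ?_ ih
    congr 1
    funext A x; cases x <;> rfl

/-- Extension of a substitution by a term for a new variable. -/
def Sub.cons {Γ Δ : List Ty} {B : Ty} (a : Tm C Δ B) (σ : Sub C Γ Δ) : Sub C (B :: Γ) Δ
  | _, Var.here => a
  | _, Var.there x => σ _ x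

theorem Tm.subst_lift_single {Γ Δ : List Ty} {A B : Ty} (b : Tm C (A :: Γ) B) (σ : Sub C Γ Δ)
    (a : Tm C Δ A) : (b.subst σ.lift).subst (Sub.single a) = b.subst (Sub.cons a σ) := by
  rw [Tm.subst_subst]
  congr 1
  funext D x
  cases x with
  | here => rfl
  | there x =>
    simp only [Sub.lift, Tm.subst_rename]
    exact Tm.subst_var _

/-! ### The full set-theoretic model over the set of constants -/

/-- The full function hierarchy over `C`. -/
@[reducible] def Ty.Den (C : Type u) : Ty → Type u
  | Ty.ground => C
  | Ty.arr A B => A.Den C → B.Den C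

/-- Valuations of the variables of a context. -/
abbrev Env (C : Type u) (Γ : List Ty) : Type u := ∀ A : Ty, Var Γ A → A.Den C

def Env.nil : Env C [] := fun _ x => nomatch x

def Env.cons {Γ : List Ty} {B : Ty} (d : B.Den C) (γ : Env C Γ) : Env C (B :: Γ)
  | _, Var.here => d
  | _, Var.there x => γ _ x

theorem Env.eq_nil (γ : Env C []) : γ = Env.nil := by
  funext A x; cases x

def Tm.eval : {Γ : List Ty} → {A : Ty} → Tm C Γ A → Env C Γ → A.Den C
  | _, _, Tm.const c, _ => c
  | _, _, Tm.var x, γ => γ _ x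
  | _, _, Tm.app f a, γ => (f.eval γ) (a.eval γ)
  | _, _, Tm.lam b, γ => fun d => b.eval (Env.cons d γ)

theorem Tm.eval_rename {Γ Δ : List Ty} {A : Ty} (t : Tm C Γ A) (ρ : Ren Γ Δ) (γ : Env C Δ) :
    (t.rename ρ).eval γ = t.eval (fun A x => γ A (ρ A x)) := by
  induction t generalizing Δ with
  | const c => rfl
  | var x => rfl
  | app f a ihf iha => simp only [Tm.rename, Tm.eval, ihf, iha]
  | lam b ih =>
    simp only [Tm.rename, Tm.eval, ih]
    funext d
    congr 1
    funext A x; cases x <;> rfl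

theorem Tm.eval_subst {Γ Δ : List Ty} {A : Ty} (t : Tm C Γ A) (σ : Sub C Γ Δ) (γ : Env C Δ) :
    (t.subst σ).eval γ = t.eval (fun A x => (σ A x).eval γ) := by
  induction t generalizing Δ with
  | const c => rfl
  | var x => rfl
  | app f a ihf iha => simp only [Tm.subst, Tm.eval, ihf, iha]
  | lam b ih =>
    simp only [Tm.subst, Tm.eval, ih]
    funext d
    congr 1
    funext A x
    cases x with
    | here => rfl
    | there x =>
      simp only [Sub.lift, Tm.eval_rename]
      rfl

/-- The value of a closed term. -/
def Tm.value {A : Ty} (t : Closed C A) : A.Den C := t.eval Env.nil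

/-- The valuation defined by a closed substitution. -/
def Sub.values {Γ : List Ty} (σ : Sub C Γ []) : Env C Γ := fun A x => (σ A x).value

theorem Tm.value_subst {Γ : List Ty} {A : Ty} (t : Tm C Γ A) (σ : Sub C Γ []) :
    (t.subst σ).value = t.eval σ.values := Tm.eval_subst t σ _

theorem Sub.values_cons {Γ : List Ty} {A : Ty} (a : Closed C A) (σ : Sub C Γ []) :
    (Sub.cons a σ).values = Env.cons a.value σ.values := by
  funext D x; cases x <;> rfl

theorem Tm.eval_rename_closed {Γ : List Ty} {A : Ty} (t : Closed C A) (ρ : Ren [] Γ)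
    (γ : Env C Γ) : (t.rename ρ).eval γ = t.value := by
  rw [Tm.eval_rename, Tm.value]
  congr 1
  exact Env.eq_nil _

/-! ### Canonicity -/

theorem BetaEq.trans {Γ : List Ty} {A : Ty} {t s r : Tm C Γ A} (h : BetaEq t s)
    (h' : BetaEq s r) : BetaEq t r := Relation.EqvGen.trans _ _ _ h h'

theorem BetaEq.symm {Γ : List Ty} {A : Ty} {t s : Tm C Γ A} (h : BetaEq t s) : BetaEq s t :=
  Relation.EqvGen.symm _ _ h

/-- The closed term `t` computes the element `d` of the model. -/
def Computes : {A : Ty} → Closed C A → A.Den C → Prop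
  | Ty.ground, t, c => BetaEq t (Tm.const c)
  | Ty.arr A _, t, f => ∀ (a : Closed C A) (d : A.Den C), Computes a d → Computes (Tm.app t a) (f d)

theorem Computes.of_beta {A : Ty} {t s : Closed C A} {d : A.Den C} (h : Beta t s)
    (hs : Computes s d) : Computes t d := by
  induction A with
  | ground => exact BetaEq.trans (Relation.EqvGen.rel _ _ h) hs
  | arr A B _ ihB => exact fun a e ha => ihB (Beta.appL a h) (hs a e ha)

/-- Fundamental lemma of the logical relation between closed terms and elements of the model;
abstractions are handled by closure under β-expansion. -/
theorem Tm.computes_subst {Γ : List Ty} {A : Ty} (t : Tm C Γ A) (σ : Sub C Γ []) (γ : Env C Γ)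
    (h : ∀ A x, Computes (σ A x) (γ A x)) : Computes (t.subst σ) (t.eval γ) := by
  induction t with
  | const c => exact Relation.EqvGen.refl _
  | var x => exact h _ x
  | app f a ihf iha => exact ihf σ γ h _ _ (iha σ γ h)
  | lam b ih =>
    intro a d had
    refine Computes.of_beta (Beta.beta _ _) ?_
    rw [Tm.subst_lift_single]
    refine ih _ (Env.cons d γ) ?_
    intro A x
    cases x with
    | here => exact had
    | there x => exact h _ x

theorem Tm.computes_value {A : Ty} (t : Closed C A) : Computes t t.value := by
  have h := Tm.computes_subst t (fun _ x => Tm.var x) Env.nil (fun _ x => nomatch x)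
  rwa [Tm.subst_var] at h

/-! ### Agreement on definable arguments -/

/-- Two elements of the model give the same results on all closed arguments. -/
def Agree : {A : Ty} → A.Den C → A.Den C → Prop
  | Ty.ground, c, d => c = d
  | Ty.arr A _, f, g => ∀ a : Closed C A, Agree (f a.value) (g a.value)

theorem obsEq_of_agree {A : Ty} {t s : Closed C A} (h : Agree t.value s.value) : ObsEq t s := by
  induction A with
  | ground =>
    have ht : BetaEq t (Tm.const t.value) := t.computes_value
    have hs : BetaEq s (Tm.const s.value) := s.computes_value
    have h' : t.value = s.value := h
    rw [h'] at ht
    exact ht.trans hs.symm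
  | arr A B _ ihB => exact fun a _ => ihB (h a)

/-- The logical relation over equality, restricted to definable arguments. -/
def Rel : {A : Ty} → A.Den C → A.Den C → Prop
  | Ty.ground, c, d => c = d
  | Ty.arr A _, f, g =>
      ∀ a a' : Closed C A, Rel a.value a'.value → Rel (f a.value) (g a'.value)

/-- Fundamental lemma for `Rel`. The valuations must come from closed substitutions, because `Rel`
tests functions on definable arguments only. -/
theorem Tm.rel_eval {Γ : List Ty} {A : Ty} (t : Tm C Γ A) (σ τ : Sub C Γ [])
    (h : ∀ A x, Rel (σ A x).value (τ A x).value) : Rel (t.eval σ.values) (t.eval τ.values) := by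
  induction t with
  | const c => exact rfl
  | var x => exact h _ x
  | app f a ihf iha =>
    have := ihf σ τ h (a.subst σ) (a.subst τ)
    rw [Tm.value_subst, Tm.value_subst] at this
    exact this (iha σ τ h)
  | lam b ih =>
    intro a a' haa
    have := ih (Sub.cons a σ) (Sub.cons a' τ) (by
      intro A x
      cases x with
      | here => exact haa
      | there x => exact h _ x)
    rwa [Sub.values_cons, Sub.values_cons] at this

theorem Tm.rel_value {A : Ty} (t : Closed C A) : Rel t.value t.value := by
  have h := Tm.rel_eval t (fun _ x => Tm.var x) (fun _ x => Tm.var x) (fun _ x => nomatch x)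
  rwa [Env.eq_nil (Sub.values _)] at h

theorem Rel.trans {A : Ty} {f g h : A.Den C} (hfg : Rel f g) (hgh : Rel g h) : Rel f h := by
  induction A with
  | ground => exact Eq.trans hfg hgh
  | arr A B _ ihB => exact fun a a' haa => ihB (hfg a a' haa) (hgh a' a' a'.rel_value)

theorem Rel.agree {A : Ty} {f g : A.Den C} (h : Rel f g) : Agree f g := by
  induction A with
  | ground => exact h
  | arr A B _ ihB => exact fun a => ihB (h a a a.rel_value)

/-- Definability is essential: `t` is exchanged for `s` at the fixed argument `a`, and then `a` for
`a'` inside `s`, which is related to itself because it is a closed term. -/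
theorem Agree.rel {A : Ty} {t s : Closed C A} (h : Agree t.value s.value) :
    Rel t.value s.value := by
  induction A with
  | ground => exact h
  | arr A B _ ihB =>
    intro a a' haa
    have h₁ : Rel (Tm.app t a).value (Tm.app s a).value := ihB (h a)
    exact h₁.trans (s.rel_value a a' haa)

/-- Closed terms send arguments that agree to results that agree. -/
theorem Agree.app_congr {A B : Ty} (f : Closed C (Ty.arr A B)) {t s : Closed C A}
    (h : Agree t.value s.value) : Agree (f.value t.value) (f.value s.value) :=
  (f.rel_value t s h.rel).agree

/-! ### η-long β-normal forms -/

/-- Neutral terms (`Normal true`) and η-long β-normal forms (`Normal false`). -/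
inductive Normal : Bool → {Γ : List Ty} → {A : Ty} → Tm C Γ A → Prop
  | var {Γ : List Ty} {A : Ty} (x : Var Γ A) : Normal true (Tm.var x)
  | app {Γ : List Ty} {A B : Ty} {f : Tm C Γ (Ty.arr A B)} {a : Tm C Γ A} :
      Normal true f → Normal false a → Normal true (Tm.app f a)
  | neutral {Γ : List Ty} {t : Tm C Γ Ty.ground} : Normal true t → Normal false t
  | const {Γ : List Ty} (c : C) : Normal false (Tm.const c : Tm C Γ Ty.ground)
  | lam {Γ : List Ty} {A B : Ty} {b : Tm C (A :: Γ) B} : Normal false b → Normal false (Tm.lam b)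

theorem Normal.rename {k : Bool} {Γ Δ : List Ty} {A : Ty} {t : Tm C Γ A} (h : Normal k t)
    (ρ : Ren Γ Δ) : Normal k (t.rename ρ) := by
  induction h generalizing Δ with
  | var x => exact .var _
  | app _ _ ihf iha => exact .app (ihf ρ) (iha ρ)
  | neutral _ ih => exact .neutral (ih ρ)
  | const c => exact .const c
  | lam _ ih => exact .lam (ih ρ.lift)

/-- The Kripke predicate of normalization by evaluation. -/
def Reducible : (A : Ty) → (Γ : List Ty) → (Env C Γ → A.Den C) → Prop
  | Ty.ground, Γ, F => ∃ n : Tm C Γ Ty.ground, Normal false n ∧ n.eval = F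
  | Ty.arr A B, Γ, F => ∀ (Δ : List Ty) (ρ : Ren Γ Δ) (G : Env C Δ → A.Den C),
      Reducible A Δ G → Reducible B Δ (fun δ => F (fun D x => δ D (ρ D x)) (G δ))

theorem Reducible.rename {A : Ty} {Γ Δ : List Ty} {F : Env C Γ → A.Den C} (h : Reducible A Γ F)
    (ρ : Ren Γ Δ) : Reducible A Δ (fun δ => F (fun D x => δ D (ρ D x))) := by
  cases A with
  | ground =>
    obtain ⟨n, hn, rfl⟩ := h
    exact ⟨n.rename ρ, hn.rename ρ, funext fun δ => Tm.eval_rename _ _ _⟩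
  | arr A B => exact fun Θ ρ' G hG => h Θ (fun D x => ρ' D (ρ D x)) G hG

/-- Reflection and reification, proved together because the function type mixes them: a reflected
neutral term reifies its argument, and reification of a function applies it to a reflected fresh
variable. -/
theorem reducible_neutral_and_exists_normal (A : Ty) :
    (∀ (Γ : List Ty) (n : Tm C Γ A), Normal true n → Reducible A Γ n.eval) ∧
      ∀ (Γ : List Ty) (F : Env C Γ → A.Den C), Reducible A Γ F →
        ∃ n : Tm C Γ A, Normal false n ∧ n.eval = F := by
  induction A with
  | ground => exact ⟨fun Γ n hn => ⟨n, .neutral hn, rfl⟩, fun Γ F h => h⟩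
  | arr A B ihA ihB =>
    refine ⟨fun Γ n hn Δ ρ G hG => ?_, fun Γ F h => ?_⟩
    · obtain ⟨a, ha, rfl⟩ := ihA.2 Δ G hG
      have := ihB.1 Δ (Tm.app (n.rename ρ) a) (.app (hn.rename ρ) ha)
      simpa only [Tm.eval, Tm.eval_rename, funext_iff] using this
    · obtain ⟨b, hb, hbF⟩ := ihB.2 (A :: Γ) _
        (h (A :: Γ) (fun _ x => Var.there x) _ (ihA.1 _ _ (.var Var.here)))
      refine ⟨Tm.lam b, .lam hb, ?_⟩
      funext γ d
      simp only [Tm.eval, hbF]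
      rfl

theorem Tm.reducible_eval {Γ Δ : List Ty} {A : Ty} (t : Tm C Γ A)
    (G : ∀ A, Var Γ A → Env C Δ → A.Den C) (hG : ∀ A x, Reducible A Δ (G A x)) :
    Reducible A Δ (fun δ => t.eval (fun A x => G A x δ)) := by
  induction t generalizing Δ with
  | const c => exact ⟨Tm.const c, .const c, rfl⟩
  | var x => exact hG _ x
  | app f a ihf iha => exact ihf G hG Δ (fun _ x => x) _ (iha G hG)
  | lam b ih =>
    intro Θ ρ H hH
    have := ih (Δ := Θ) (fun A x δ => (Env.cons (H δ) (fun A x => G A x (fun D x => δ D (ρ D x))) :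
        Env C _) A x) (by
      intro A x
      cases x with
      | here => exact hH
      | there x => exact (hG _ x).rename ρ)
    exact this

/-- Every term has the same values as some η-long β-normal form. -/
theorem Tm.exists_normal {Γ : List Ty} {A : Ty} (t : Tm C Γ A) :
    ∃ n : Tm C Γ A, Normal false n ∧ n.eval = t.eval :=
  (reducible_neutral_and_exists_normal A).2 Γ _
    (t.reducible_eval (fun _ x γ => γ _ x)
      (fun A x => (reducible_neutral_and_exists_normal A).1 Γ (Tm.var x) (.var x)))

/-- The renaming of closed terms into an arbitrary context. -/
def Ren.ofNil {Γ : List Ty} : Ren [] Γ := fun _ x => nomatch x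

/-! ### Full lists of arguments -/

/-- Full lists of arguments for the elements of type `A`. -/
def Ty.Args (C : Type u) : Ty → Type u
  | Ty.ground => PUnit
  | Ty.arr A B => A.Den C × B.Args C

def Ty.apply : (A : Ty) → A.Den C → A.Args C → C
  | Ty.ground, c, _ => c
  | Ty.arr _ B, f, as => B.apply (f as.1) as.2

def Ty.curry : (A : Ty) → (A.Args C → C) → A.Den C
  | Ty.ground, F => F PUnit.unit
  | Ty.arr _ B, F => fun d => B.curry (fun as => F (d, as))

theorem Ty.apply_curry (A : Ty) (F : A.Args C → C) (as : A.Args C) :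
    A.apply (A.curry F) as = F as := by
  induction A with
  | ground => rfl
  | arr A B _ ih => exact ih _ _

/-- `ArgVar A B`: the positions of type `B` in the full lists of arguments for type `A`. -/
inductive ArgVar : Ty → Ty → Type
  | here {A B : Ty} : ArgVar (Ty.arr A B) A
  | there {A B D : Ty} : ArgVar B D → ArgVar (Ty.arr A B) D

def ArgVar.get : {A D : Ty} → ArgVar A D → A.Args C → D.Den C
  | _, _, ArgVar.here, as => as.1
  | _, _, ArgVar.there v, as => v.get as.2

/-- The context `Γ` extended with variables for a full list of arguments for type `A`. -/
def Ty.ctx : Ty → List Ty → List Ty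
  | Ty.ground, Γ => Γ
  | Ty.arr A B, Γ => B.ctx (A :: Γ)

def Ty.weaken : (A : Ty) → {Γ : List Ty} → Ren Γ (A.ctx Γ)
  | Ty.ground, _, _, x => x
  | Ty.arr _ B, _, _, x => B.weaken _ (Var.there x)

def ArgVar.toVar : {A D : Ty} → ArgVar A D → (Γ : List Ty) → Var (A.ctx Γ) D
  | Ty.arr _ B, _, ArgVar.here, _ => B.weaken _ Var.here
  | Ty.arr A _, _, ArgVar.there v, Γ => v.toVar (A :: Γ)

def Env.extend : (A : Ty) → {Γ : List Ty} → Env C Γ → A.Args C → Env C (A.ctx Γ)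
  | Ty.ground, _, γ, _ => γ
  | Ty.arr _ B, _, γ, as => Env.extend B (Env.cons as.1 γ) as.2

theorem Env.extend_weaken (A : Ty) {Γ : List Ty} (γ : Env C Γ) (as : A.Args C) {D : Ty}
    (x : Var Γ D) : Env.extend A γ as D (A.weaken D x) = γ D x := by
  induction A generalizing Γ with
  | ground => rfl
  | arr A B _ ih => exact ih _ _ _

theorem Env.extend_toVar {A D : Ty} (v : ArgVar A D) {Γ : List Ty} (γ : Env C Γ)
    (as : A.Args C) : Env.extend A γ as D (v.toVar Γ) = v.get as := by
  induction v generalizing Γ with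
  | here => exact Env.extend_weaken _ _ _ _
  | there v ih => exact ih _ _

theorem Ty.ctx_var_cases (A : Ty) {Γ : List Ty} {D : Ty} (x : Var (A.ctx Γ) D) :
    (∃ v : ArgVar A D, x = v.toVar Γ) ∨ ∃ y : Var Γ D, x = A.weaken D y := by
  induction A generalizing Γ with
  | ground => exact .inr ⟨x, rfl⟩
  | arr A B _ ih =>
    rcases ih x with ⟨v, rfl⟩ | ⟨y, rfl⟩
    · exact .inl ⟨.there v, rfl⟩
    · cases y with
      | here => exact .inl ⟨.here, rfl⟩
      | there y => exact .inr ⟨y, rfl⟩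

/-- Abstraction of a full list of arguments. -/
def Tm.lams : (A : Ty) → {Γ : List Ty} → Tm C (A.ctx Γ) Ty.ground → Tm C Γ A
  | Ty.ground, _, b => b
  | Ty.arr _ B, _, b => Tm.lam (Tm.lams B b)

theorem Tm.eval_lams (A : Ty) {Γ : List Ty} (b : Tm C (A.ctx Γ) Ty.ground) (γ : Env C Γ) :
    (Tm.lams A b).eval γ = A.curry (fun as => b.eval (Env.extend A γ as)) := by
  induction A generalizing Γ with
  | ground => rfl
  | arr A B _ ih => exact funext fun d => ih _ _

theorem Tm.EtaLong.lams (A : Ty) {Γ : List Ty} {b : Tm C (A.ctx Γ) Ty.ground}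
    (hb : b.EtaLong) : (Tm.lams A b).EtaLong := by
  induction A generalizing Γ with
  | ground => exact hb
  | arr A B _ ih => exact ⟨ih hb, trivial⟩

theorem CellularUnder.lams (A : Ty) {Γ : List Ty} {b : Tm C (A.ctx Γ) Ty.ground}
    (hb : CellularBody b) : CellularUnder (Tm.lams A b) := by
  induction A generalizing Γ with
  | ground => exact .body hb
  | arr A B _ ih => exact .lam (ih hb)

/-- Application of a weakened term to the variables of its full list of arguments. -/
def Tm.appVars : (A : Ty) → {Γ : List Ty} → Tm C Γ A → Tm C (A.ctx Γ) Ty.ground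
  | Ty.ground, _, t => t
  | Ty.arr _ B, _, t => Tm.appVars B (Tm.app (t.rename (fun _ x => Var.there x)) (Tm.var Var.here))

theorem Tm.eval_appVars (A : Ty) {Γ : List Ty} (t : Tm C Γ A) (γ : Env C Γ) (as : A.Args C) :
    (Tm.appVars A t).eval (Env.extend A γ as) = A.apply (t.eval γ) as := by
  induction A generalizing Γ with
  | ground => rfl
  | arr A B _ ih =>
    refine (ih _ _ _).trans ?_
    simp only [Tm.eval, Tm.eval_rename, Ty.apply]
    rfl

/-! ### Values of cells -/

/-- The valuation of the holes. -/
def holeEnv : (K : ℕ) → (Fin K → C) → Env C (holes K)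
  | _ + 1, v, _, Var.here => v 0
  | K + 1, v, _, Var.there x => holeEnv K (fun j => v j.succ) _ x

def holeVar : (K : ℕ) → Fin K → Var (holes K) Ty.ground
  | _ + 1, ⟨0, _⟩ => Var.here
  | K + 1, ⟨k + 1, h⟩ => Var.there (holeVar K ⟨k, Nat.lt_of_succ_lt_succ h⟩)

theorem holeEnv_holeVar (K : ℕ) (v : Fin K → C) (k : Fin K) :
    holeEnv K v _ (holeVar K k) = v k := by
  induction K with
  | zero => exact k.elim0
  | succ K ih =>
    obtain ⟨k, hk⟩ := k
    cases k with
    | zero => rfl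
    | succ k => exact ih (fun j => v j.succ) ⟨k, _⟩

theorem eval_fillSub (K : ℕ) {Δ : List Ty} (w : Fin K → Tm C Δ Ty.ground) (δ : Env C Δ) :
    (fun A x => (fillSub K w A x).eval δ) = holeEnv K (fun k => (w k).eval δ) := by
  funext A x
  induction K with
  | zero => cases x
  | succ K ih =>
    cases x with
    | here => rfl
    | there x => exact ih _ x

theorem holes_var_eq (K : ℕ) {A : Ty} (x : Var (holes K) A) :
    ∃ k, (⟨A, x⟩ : Σ A, Var (holes K) A) = ⟨Ty.ground, holeVar K k⟩ := by
  induction K with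
  | zero => cases x
  | succ K ih =>
    cases x with
    | here => exact ⟨0, rfl⟩
    | there x =>
      obtain ⟨k, hk⟩ := ih x
      cases hk
      exact ⟨k.succ, rfl⟩

/-- The value of a head applied to the arguments of a cell, given the values of the holes. -/
def CellArgs.val {K : ℕ} (v : Fin K → C) : {A : Ty} → CellArgs C K A → A.Den C → C
  | _, CellArgs.nil, h => h
  | _, CellArgs.cons E Es, h => Es.val v (h (E.body.eval (holeEnv K v)))

theorem CellArgs.eval_applyTo {K : ℕ} {Δ : List Ty} {A : Ty} (E : CellArgs C K A)
    (w : Fin K → Tm C Δ Ty.ground) (h : Tm C Δ A) (δ : Env C Δ) :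
    (E.applyTo w h).eval δ = E.val (fun k => (w k).eval δ) (h.eval δ) := by
  induction E with
  | nil => rfl
  | cons E Es ih =>
    simp only [CellArgs.applyTo, ih, CellArgs.val, Tm.eval, ClosedContext.fill, Tm.eval_subst,
      eval_fillSub]

/-! ### Cellular terms are η-long -/

theorem Tm.expanded_of_ground {Γ : List Ty} {A : Ty} (t : Tm C Γ A) (h : A = Ty.ground) :
    t.Expanded := by
  cases t <;> trivial

theorem Tm.EtaLong.rename {Γ Δ : List Ty} {A : Ty} {t : Tm C Γ A} (h : t.EtaLong) (ρ : Ren Γ Δ) :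
    (t.rename ρ).EtaLong := by
  have he : ∀ {Γ Δ : List Ty} {A : Ty} (t : Tm C Γ A) (ρ : Ren Γ Δ), t.Expanded →
      (t.rename ρ).Expanded := by
    intro Γ Δ A t ρ h
    cases t <;> exact h
  refine ⟨?_, he _ _ h.2⟩
  replace h := h.1
  induction t generalizing Δ with
  | const c => trivial
  | var x => trivial
  | app f a ihf iha => exact ⟨ihf ρ h.1, iha ρ h.2.1, he _ _ h.2.2⟩
  | lam b ih => exact ⟨ih _ h.1, he _ _ h.2⟩

/-- A substitution that replaces each variable by a variable or by an η-long term of ground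
type. -/
def Sub.GroundEtaLong {Γ Δ : List Ty} (σ : Sub C Γ Δ) : Prop :=
  ∀ A x, (σ A x).EtaLongInside ∧ (A = Ty.ground ∨ ∃ y, σ A x = Tm.var y)

theorem Sub.GroundEtaLong.lift {Γ Δ : List Ty} {B : Ty} {σ : Sub C Γ Δ} (h : σ.GroundEtaLong) :
    (Sub.lift σ : Sub C (B :: Γ) (B :: Δ)).GroundEtaLong := by
  intro A x
  cases x with
  | here => exact ⟨trivial, .inr ⟨_, rfl⟩⟩
  | there x =>
    obtain ⟨h₁, rfl | ⟨y, hy⟩⟩ := h A x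
    · exact ⟨(Tm.EtaLong.rename ⟨h₁, Tm.expanded_of_ground _ rfl⟩ _).1, .inl rfl⟩
    · refine ⟨?_, .inr ⟨Var.there y, ?_⟩⟩ <;> simp only [Sub.lift, hy, Tm.rename]
      trivial

theorem Tm.Expanded.subst {Γ Δ : List Ty} {A : Ty} {t : Tm C Γ A} (h : t.Expanded)
    (σ : Sub C Γ Δ) : (t.subst σ).Expanded := by
  cases t with
  | var x => exact Tm.expanded_of_ground _ h
  | _ => exact h

theorem Tm.EtaLongInside.subst {Γ Δ : List Ty} {A : Ty} {t : Tm C Γ A} (h : t.EtaLongInside)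
    {σ : Sub C Γ Δ} (hσ : σ.GroundEtaLong) : (t.subst σ).EtaLongInside := by
  induction t generalizing Δ with
  | const c => trivial
  | var x => exact (hσ _ x).1
  | app f a ihf iha => exact ⟨ihf h.1 hσ, iha h.2.1 hσ, h.2.2.subst σ⟩
  | lam b ih => exact ⟨ih h.1 hσ.lift, h.2.subst _⟩

theorem fillSub_groundEtaLong (K : ℕ) {Δ : List Ty} (w : Fin K → Tm C Δ Ty.ground)
    (hw : ∀ k, (w k).EtaLongInside) : (fillSub K w).GroundEtaLong := by
  intro A x
  induction K with
  | zero => cases x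
  | succ K ih =>
    cases x with
    | here => exact ⟨hw 0, .inl rfl⟩
    | there x => exact ih _ (fun k => hw k.succ) x

theorem CellArgs.etaLongInside_applyTo {K : ℕ} {Δ : List Ty} {A : Ty} (E : CellArgs C K A)
    (w : Fin K → Tm C Δ Ty.ground) (hw : ∀ k, (w k).EtaLongInside) (h : Tm C Δ A)
    (hh : h.EtaLongInside) : (E.applyTo w h).EtaLongInside := by
  induction E with
  | nil => exact hh
  | cons E Es ih =>
    exact ih _ ⟨hh, E.etaLong.1.subst (fillSub_groundEtaLong K w hw), E.etaLong.2.subst _⟩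

theorem CellularBody.etaLong {Δ : List Ty} {u : Tm C Δ Ty.ground} (h : CellularBody u) :
    u.EtaLong := by
  refine ⟨?_, Tm.expanded_of_ground _ rfl⟩
  induction h with
  | const c => trivial
  | cell S w _ ih => exact S.args.etaLongInside_applyTo w ih _ trivial

/-! ### Closed functions on the model -/

/-- A neutral term over a single variable `X` sends constant functions to constant functions. -/
theorem Normal.eval_curry_const {k : Bool} {Γ : List Ty} {B : Ty} {n : Tm C Γ B}
    (h : Normal k n) (hk : k = true) {A : Ty} (hΓ : Γ = [A]) (γ : Env C Γ) (c : C)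
    (hγ : ∀ D x, γ D x = D.curry (fun _ => c)) : n.eval γ = B.curry (fun _ => c) := by
  induction h with
  | var x => exact hγ _ x
  | app _ _ ih _ =>
    -- A curried constant function absorbs one argument and stays a curried constant function.
    simp only [Tm.eval, ih hk hΓ γ hγ]
    rfl
  | _ => cases hk

/-- A closed function from type `A` to the ground type is constant, or returns the value of the
constant functions. -/
theorem Tm.constant_or_curry_const {A : Ty} (f : Tm C [A] Ty.ground) :
    (∃ e, ∀ X : A.Den C, f.eval (Env.cons X Env.nil) = e) ∨
      ∀ c, f.eval (Env.cons (A.curry (fun _ => c)) Env.nil) = c := by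
  obtain ⟨n, hn, hnf⟩ := f.exists_normal
  rw [← hnf]
  cases hn with
  | const c => exact .inl ⟨c, fun _ => rfl⟩
  | neutral hn =>
    refine .inr fun c => hn.eval_curry_const rfl rfl _ c fun D x => ?_
    cases x with
    | here => rfl
    | there x => cases x

/-- An application would have a head of function type, whereas all holes are ground. The type is
packed with the term so that this clash can be refuted by `cases`. -/
theorem Normal.exists_holeVar {k : Bool} {Γ : List Ty} {B : Ty} {n : Tm C Γ B}
    (h : Normal k n) (hk : k = true) {K : ℕ} (hΓ : Γ = holes K) :
    ∃ x : Fin K, (⟨B, n⟩ : Σ B, Tm C Γ B) = ⟨Ty.ground, Tm.var (hΓ ▸ holeVar K x)⟩ := by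
  induction h with
  | var x =>
    subst hΓ
    obtain ⟨k, hk⟩ := holes_var_eq K x
    cases hk
    exact ⟨k, rfl⟩
  | app _ _ ih _ =>
    obtain ⟨x, hx⟩ := ih hk hΓ
    cases hx
  | _ => cases hk

/-- A ground term over the holes is constant or a projection. -/
theorem Tm.constant_or_projection {K : ℕ} (q : Tm C (holes K) Ty.ground) :
    (∃ e, ∀ v, q.eval (holeEnv K v) = e) ∨ ∃ k, ∀ v, q.eval (holeEnv K v) = v k := by
  obtain ⟨n, hn, hnq⟩ := q.exists_normal
  rw [← hnq]
  cases hn with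
  | const c => exact .inl ⟨c, fun _ => rfl⟩
  | neutral hn =>
    obtain ⟨k, hk⟩ := hn.exists_holeVar rfl rfl
    cases hk
    exact .inr ⟨k, fun v => holeEnv_holeVar K v k⟩

theorem CellArgs.constant_or_projection {K : ℕ} {A : Ty} (E : CellArgs C K A) (a : Closed C A) :
    (∃ e, ∀ v, E.val v a.value = e) ∨ ∃ k, ∀ v, E.val v a.value = v k := by
  have h := Tm.constant_or_projection
    (E.applyTo (fun k => Tm.var (holeVar K k)) (a.rename Ren.ofNil))
  simp only [CellArgs.eval_applyTo, Tm.eval, holeEnv_holeVar, Tm.eval_rename_closed] at h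
  exact h

/-! ### Trees of cells -/

/-- Ground terms over the variables `Δ` and over local variables for the arguments of type `A`, in
the form of trees of cells, each with a local or an outer head. The leaves are cellular and do not
depend on the local variables. -/
inductive CellTree (C : Type u) (A : Ty) (Δ : List Ty) : Type u
  | leaf (w : Tm C Δ Ty.ground) (hw : CellularBody w) : CellTree C A Δ
  | inner {K : ℕ} {D : Ty} (h : ArgVar A D) (E : CellArgs C K D) (w : Fin K → CellTree C A Δ) :
      CellTree C A Δ
  | outer {K : ℕ} {D : Ty} (h : Var Δ D) (E : CellArgs C K D) (w : Fin K → CellTree C A Δ) :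
      CellTree C A Δ

namespace CellTree

variable {A : Ty} {Δ : List Ty}

def val (δ : Env C Δ) (as : A.Args C) : CellTree C A Δ → C
  | leaf w _ => w.eval δ
  | inner h E w => E.val (fun k => (w k).val δ as) (h.get as)
  | outer h E w => E.val (fun k => (w k).val δ as) (δ _ h)

/-- The number of outer cells. -/
def count : CellTree C A Δ → ℕ
  | leaf _ _ => 0
  | inner _ _ w => ∑ k, (w k).count
  | outer _ _ w => 1 + ∑ k, (w k).count

/-- The tree as a term, after a closed substitution for the outer variables. -/
def toTm (σ : Sub C Δ []) {Ω : List Ty} (ι : ∀ D, ArgVar A D → Var Ω D) :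
    CellTree C A Δ → Tm C Ω Ty.ground
  | leaf w _ => (w.subst σ).rename Ren.ofNil
  | inner h E w => E.applyTo (fun k => (w k).toTm σ ι) (Tm.var (ι _ h))
  | outer h E w => E.applyTo (fun k => (w k).toTm σ ι) ((σ _ h).rename Ren.ofNil)

theorem eval_toTm (σ : Sub C Δ []) {Ω : List Ty} (ι : ∀ D, ArgVar A D → Var Ω D) (ω : Env C Ω)
    (as : A.Args C) (hω : ∀ D v, ω D (ι D v) = v.get as) (T : CellTree C A Δ) :
    (T.toTm σ ι).eval ω = T.val σ.values as := by
  induction T with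
  | leaf w _ => simp only [toTm, Tm.eval_rename_closed, Tm.value_subst, val]
  | inner h E w ih => simp only [toTm, CellArgs.eval_applyTo, ih, Tm.eval, hω, val]
  | outer h E w ih =>
    simp only [toTm, CellArgs.eval_applyTo, ih, Tm.eval_rename_closed, val]
    rfl

/-- The element of type `A` obtained by abstraction of the local variables. -/
def abs (δ : Env C Δ) (T : CellTree C A Δ) : A.Den C := A.curry (fun as => T.val δ as)

def absTm (σ : Sub C Δ []) (Γ : List Ty) (T : CellTree C A Δ) : Tm C Γ A :=
  Tm.lams A (T.toTm σ (fun _ v => v.toVar Γ))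

theorem eval_absTm (σ : Sub C Δ []) {Γ : List Ty} (γ : Env C Γ) (T : CellTree C A Δ) :
    (T.absTm σ Γ).eval γ = T.abs σ.values := by
  rw [absTm, Tm.eval_lams, abs]
  congr 1
  funext as
  exact eval_toTm σ _ _ as (fun D v => Env.extend_toVar v γ as) T

/-- Selects an outer cell with only inner cells above it. The last clause says that plugging is
definable: `P` depends on the term `x` denoting the plugged subtree, but not on the subtree itself.
-/
theorem exists_plug (T : CellTree C A Δ) (hT : T.count ≠ 0) :
    ∃ (plug : CellTree C A Δ → CellTree C A Δ) (K : ℕ) (D : Ty) (h : Var Δ D) (E : CellArgs C K D)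
      (w : Fin K → CellTree C A Δ), plug (outer h E w) = T ∧
      (∃ m, ∀ t, (plug t).count = m + t.count) ∧
      ∀ (σ : Sub C Δ []) (Ω : List Ty) (ι : ∀ D, ArgVar A D → Var Ω D) (x : Tm C Ω Ty.ground),
        ∃ P : Tm C Ω Ty.ground, ∀ (t : CellTree C A Δ) (ω : Env C Ω) (as : A.Args C),
          (∀ D v, ω D (ι D v) = v.get as) → x.eval ω = t.val σ.values as →
          P.eval ω = (plug t).val σ.values as := by
  induction T with
  | leaf w hw => exact absurd rfl hT
  | outer h E w _ =>
    exact ⟨id, _, _, h, E, w, rfl, ⟨0, fun t => (Nat.zero_add _).symm⟩,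
      fun σ Ω ι x => ⟨x, fun t ω as _ hx => hx⟩⟩
  | @inner K D h E w ih =>
    obtain ⟨k₀, -, hk₀⟩ := Finset.exists_ne_zero_of_sum_ne_zero hT
    obtain ⟨plug, K', D', h', E', w', hplug, ⟨m, hm⟩, hP⟩ := ih k₀ hk₀
    refine ⟨fun t => inner h E (Function.update w k₀ (plug t)), K', D', h', E', w', ?_, ?_, ?_⟩
    · simp only [hplug, Function.update_eq_self]
    · refine ⟨m + ∑ k ∈ Finset.univ \ {k₀}, (w k).count, fun t => ?_⟩
      have : (fun k => (Function.update w k₀ (plug t) k).count) =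
          Function.update (fun k => (w k).count) k₀ (plug t).count := by
        funext k
        exact Function.apply_update (fun _ => count) w k₀ (plug t) k
      rw [count, this, Finset.sum_update_of_mem (Finset.mem_univ _), hm]
      omega
    · intro σ Ω ι x
      obtain ⟨P, hP⟩ := hP σ Ω ι x
      refine ⟨E.applyTo (Function.update (fun k => (w k).toTm σ ι) k₀ P) (Tm.var (ι _ h)), ?_⟩
      intro t ω as hω hx
      rw [CellArgs.eval_applyTo, val, Tm.eval, hω]
      congr 1
      funext k
      by_cases hk : k = k₀
      · subst hk
        simpa only [Function.update_self] using hP t ω as hω hx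
      · simpa only [Function.update_of_ne hk] using eval_toTm σ ι ω as hω (w k)

/-- All leaves are in `L`, and there are no outer cells. -/
def LeavesIn (L : List (Tm C Δ Ty.ground)) : CellTree C A Δ → Prop
  | leaf w _ => w ∈ L
  | inner _ _ w => ∀ k, (w k).LeavesIn L
  | outer _ _ _ => False

theorem LeavesIn.mono {L L' : List (Tm C Δ Ty.ground)} (hL : L ⊆ L') {T : CellTree C A Δ}
    (h : T.LeavesIn L) : T.LeavesIn L' := by
  induction T with
  | leaf w _ => exact hL h
  | inner _ _ w ih => exact fun k => ih k (h k)
  | outer _ _ _ => exact h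

theorem exists_leavesIn (T : CellTree C A Δ) (hT : T.count = 0) :
    ∃ L : List (Tm C Δ Ty.ground), (∀ u ∈ L, CellularBody u) ∧ T.LeavesIn L := by
  induction T with
  | leaf w hw => exact ⟨[w], by simpa using hw, List.mem_singleton_self w⟩
  | outer _ _ w => simp [count] at hT
  | inner _ _ w ih =>
    have h0 : ∀ k, (w k).count = 0 := fun k =>
      (Finset.sum_eq_zero_iff.mp hT) k (Finset.mem_univ k)
    choose L hL hw using fun k => ih k (h0 k)
    refine ⟨(List.ofFn L).flatten, ?_, fun k => (hw k).mono ?_⟩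
    · intro u hu
      obtain ⟨l, hl, hul⟩ := List.mem_flatten.mp hu
      obtain ⟨k, rfl⟩ := (List.mem_ofFn' L l).mp hl
      exact hL k u hul
    · exact fun u hu => List.mem_flatten.mpr ⟨L k, (List.mem_ofFn' L _).mpr ⟨k, rfl⟩, hu⟩

/-- Each leaf turns into a hole, read as a cell without arguments. Cellularity of `b` serves only to
obtain that it is η-long. -/
theorem LeavesIn.exists_body {L : List (Tm C Δ Ty.ground)} {T : CellTree C A Δ}
    (h : T.LeavesIn L) :
    ∃ b : Tm C (A.ctx (holes L.length)) Ty.ground, CellularBody b ∧ ∀ δ as,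
      b.eval (Env.extend A (holeEnv L.length (fun k => (L.get k).eval δ)) as) = T.val δ as := by
  induction T with
  | leaf w _ =>
    obtain ⟨k, rfl⟩ := List.get_of_mem h
    refine ⟨Tm.var (A.weaken _ (holeVar _ k)), ?_, fun δ as => ?_⟩
    · exact CellularBody.cell (K := 0) ⟨_, A.weaken _ (holeVar _ k), .nil⟩ Fin.elim0
        (fun j => j.elim0)
    · rw [Tm.eval, Env.extend_weaken, holeEnv_holeVar]
      rfl
  | inner v E w ih =>
    choose b hb hbv using fun k => ih k (h k)
    refine ⟨_, CellularBody.cell ⟨_, v.toVar _, E⟩ b hb, fun δ as => ?_⟩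
    simp only [Cell.fill, CellArgs.eval_applyTo, hbv, Tm.eval, Env.extend_toVar, val]
  | outer _ _ _ => exact h.elim

theorem LeavesIn.exists_closedContext {L : List (Tm C Δ Ty.ground)} {T : CellTree C A Δ}
    (h : T.LeavesIn L) : ∃ E : ClosedContext C L.length A, ∀ δ,
      E.body.eval (holeEnv L.length (fun k => (L.get k).eval δ)) = T.abs δ := by
  obtain ⟨b, hb, hbv⟩ := h.exists_body
  refine ⟨⟨Tm.lams A b, hb.etaLong.lams A⟩, fun δ => ?_⟩
  simp only [Tm.eval_lams, hbv, abs]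

end CellTree

/-- Cellular bodies over an extended context are trees of cells. -/
theorem CellularBody.exists_cellTree {A : Ty} {Γ : List Ty} {u : Tm C (A.ctx Γ) Ty.ground}
    (h : CellularBody u) :
    ∃ T : CellTree C A Γ, ∀ γ as, T.val γ as = u.eval (Env.extend A γ as) := by
  induction h with
  | const c => exact ⟨.leaf _ (.const c), fun _ _ => rfl⟩
  | @cell K S w _ ih =>
    choose T hT using ih
    obtain ⟨D, x, E⟩ := S
    rcases A.ctx_var_cases x with ⟨v, rfl⟩ | ⟨y, rfl⟩
    · refine ⟨.inner v E T, fun γ as => ?_⟩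
      simp only [CellTree.val, hT, Cell.fill, CellArgs.eval_applyTo, Tm.eval, Env.extend_toVar]
    · refine ⟨.outer y E T, fun γ as => ?_⟩
      simp only [CellTree.val, hT, Cell.fill, CellArgs.eval_applyTo, Tm.eval, Env.extend_weaken]

/-! ### Lists of trees as arguments -/

/-- A full list of arguments, each given by a tree of cells, for a head of type `A`. -/
inductive TreeArgs (C : Type u) (Δ : List Ty) : Ty → Type u
  | nil : TreeArgs C Δ Ty.ground
  | cons {A B : Ty} (T : CellTree C A Δ) (Ts : TreeArgs C Δ B) : TreeArgs C Δ (Ty.arr A B)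

namespace TreeArgs

variable {Δ : List Ty}

def val (δ : Env C Δ) : {A : Ty} → TreeArgs C Δ A → A.Den C → C
  | _, nil, h => h
  | _, cons T Ts, h => Ts.val δ (h (T.abs δ))

def count : {A : Ty} → TreeArgs C Δ A → ℕ
  | _, nil => 0
  | _, cons T Ts => T.count + Ts.count

def applyTo (σ : Sub C Δ []) {Γ : List Ty} : {A : Ty} → TreeArgs C Δ A → Tm C Γ A →
    Tm C Γ Ty.ground
  | _, nil, h => h
  | _, cons T Ts, h => Ts.applyTo σ (Tm.app h (T.absTm σ Γ))

theorem eval_applyTo (σ : Sub C Δ []) {Γ : List Ty} (γ : Env C Γ) {A : Ty} (Ts : TreeArgs C Δ A)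
    (h : Tm C Γ A) : (Ts.applyTo σ h).eval γ = Ts.val σ.values (h.eval γ) := by
  induction Ts with
  | nil => rfl
  | cons T Ts ih => rw [applyTo, ih, Tm.eval, T.eval_absTm, val]

/-- `Q` is F as a term with one free variable, standing for the abstracted subtree; this is what
makes `Tm.constant_or_curry_const` applicable. The head `H` accumulates the arguments that precede
the selected one. -/
theorem exists_plug {A : Ty} (Ts : TreeArgs C Δ A) (hT : Ts.count ≠ 0) :
    ∃ (B : Ty) (plug : CellTree C B Δ → TreeArgs C Δ A) (K : ℕ) (D : Ty) (h : Var Δ D)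
      (E : CellArgs C K D) (w : Fin K → CellTree C B Δ), plug (.outer h E w) = Ts ∧
      (∃ m, ∀ t, (plug t).count = m + t.count) ∧
      ∀ (σ : Sub C Δ []) (H : Tm C [B] A), ∃ Q : Tm C [B] Ty.ground, ∀ t : CellTree C B Δ,
        Q.eval (Env.cons (t.abs σ.values) Env.nil) =
          (plug t).val σ.values (H.eval (Env.cons (t.abs σ.values) Env.nil)) := by
  induction Ts with
  | nil => exact absurd rfl hT
  | @cons A A' T Ts ih =>
    by_cases hc : T.count = 0
    · obtain ⟨B, plug, K, D, h, E, w, rfl, ⟨m, hm⟩, hQ⟩ := ih (by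
        intro h
        exact hT (by rw [count, hc, h]))
      refine ⟨B, fun t => cons T (plug t), K, D, h, E, w, rfl, ⟨T.count + m, fun t => ?_⟩, ?_⟩
      · rw [count, hm, Nat.add_assoc]
      · intro σ H
        obtain ⟨Q, hQ⟩ := hQ σ (Tm.app H (T.absTm σ _))
        refine ⟨Q, fun t => ?_⟩
        rw [hQ, Tm.eval, T.eval_absTm, val]
    · obtain ⟨plug, K, D, h, E, w, rfl, ⟨m, hm⟩, hP⟩ := T.exists_plug hc
      refine ⟨A, fun t => cons (plug t) Ts, K, D, h, E, w, rfl, ⟨m + Ts.count, fun t => ?_⟩, ?_⟩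
      · rw [count, hm]
        omega
      · intro σ H
        -- The plugged subtree is recovered by applying the variable of `Q` to all the local
        -- variables.
        obtain ⟨P, hP⟩ := hP σ (A.ctx [A]) (fun _ v => v.toVar _)
          (Tm.appVars A (Tm.var Var.here))
        refine ⟨Ts.applyTo σ (Tm.app H (Tm.lams A P)), fun t => ?_⟩
        have hP' : (Tm.lams A P).eval (Env.cons (t.abs σ.values) Env.nil) =
            (plug t).abs σ.values := by
          rw [Tm.eval_lams, CellTree.abs]
          congr 1
          funext as
          refine hP t _ as (fun D v => Env.extend_toVar v _ as) ?_
          rw [Tm.eval_appVars]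
          exact A.apply_curry _ as
        rw [eval_applyTo, val, Tm.eval, hP']

/-- Quantification over all `L'` containing `L` lets the different arguments share one list of
holes. -/
theorem exists_cellArgs {A : Ty} (Ts : TreeArgs C Δ A) (hT : Ts.count = 0) :
    ∃ L : List (Tm C Δ Ty.ground), (∀ u ∈ L, CellularBody u) ∧
      ∀ L', L ⊆ L' → ∃ E : CellArgs C L'.length A, ∀ δ d,
        E.val (fun k => (L'.get k).eval δ) d = Ts.val δ d := by
  induction Ts with
  | nil => exact ⟨[], by simp, fun _ _ => ⟨.nil, fun _ _ => rfl⟩⟩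
  | cons T Ts ih =>
    obtain ⟨L₁, hL₁, hT₁⟩ := T.exists_leavesIn (Nat.eq_zero_of_add_eq_zero_right hT)
    obtain ⟨L₂, hL₂, hE⟩ := ih (Nat.eq_zero_of_add_eq_zero_left hT)
    refine ⟨L₁ ++ L₂, fun u hu => (List.mem_append.mp hu).elim (hL₁ u) (hL₂ u), fun L' hL' => ?_⟩
    obtain ⟨E, hE⟩ := hE L' fun u hu => hL' (List.mem_append_right _ hu)
    obtain ⟨F, hF⟩ := (hT₁.mono (L' := L')
      fun u hu => hL' (List.mem_append_left _ hu)).exists_closedContext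
    refine ⟨.cons F E, fun δ d => ?_⟩
    simp only [CellArgs.val, hF, hE, val]

/-- An outer head applied to trees of cells has the same values as a cellular body. -/
theorem exists_cellularBody {A : Ty} (x : Var Δ A) (Ts : TreeArgs C Δ A) :
    ∃ s : Tm C Δ Ty.ground, CellularBody s ∧
      ∀ σ : Sub C Δ [], s.eval σ.values = Ts.val σ.values (σ.values A x) := by
  induction hn : Ts.count using Nat.strong_induction_on generalizing Ts with
  | h n ih =>
  by_cases h0 : Ts.count = 0
  · obtain ⟨L, hL, hE⟩ := Ts.exists_cellArgs h0
    obtain ⟨E, hE⟩ := hE L (List.Subset.refl L)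
    refine ⟨_, CellularBody.cell ⟨A, x, E⟩ L.get (fun k => hL _ (List.get_mem L k)), fun σ => ?_⟩
    rw [Cell.fill, CellArgs.eval_applyTo]
    exact hE _ _
  · obtain ⟨B, plug, K, D, y, E, w, rfl, ⟨m, hm⟩, hQ⟩ := Ts.exists_plug h0
    have hcount : n = m + (1 + ∑ k, (w k).count) := by rw [← hn, hm, CellTree.count]
    -- `r k` is the cellular form of F[wₖ], where the selected outer cell has been replaced by its
    -- `k`-th subtree.
    have hr : ∀ k, ∃ r : Tm C Δ Ty.ground, CellularBody r ∧ ∀ σ : Sub C Δ [],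
        r.eval σ.values = (plug (w k)).val σ.values (σ.values A x) := fun k => by
      refine ih _ ?_ (plug (w k)) rfl
      have := Finset.single_le_sum (f := fun k => (w k).count) (fun _ _ => Nat.zero_le _)
        (Finset.mem_univ k)
      rw [hm, hcount]
      omega
    choose r hr hrv using hr
    have hs := CellularBody.cell ⟨D, y, E⟩ r hr
    -- The selected cell filled with the `r k` is cellular over `Δ`, hence a leaf, which removes it
    -- from the count.
    obtain ⟨q, hq, hqv⟩ := ih _ (by rw [hm, hcount, CellTree.count]; omega)
      (plug (.leaf _ hs)) rfl
    refine ⟨q, hq, fun σ => ?_⟩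
    rw [hqv]
    obtain ⟨Q, hQ⟩ := hQ σ ((σ A x).rename Ren.ofNil)
    simp only [Tm.eval_rename_closed] at hQ
    change (plug _).val _ (σ A x).value = (plug _).val _ (σ A x).value
    rw [← hQ, ← hQ]
    have hleaf : (CellTree.leaf (A := B) _ hs).abs σ.values =
        B.curry (fun _ => E.val (fun k => (r k).eval σ.values) (σ D y).value) := by
      simp only [CellTree.abs, CellTree.val, Cell.fill, CellArgs.eval_applyTo, Tm.eval]
      rfl
    have houter : (CellTree.outer y E w).abs σ.values =
        B.curry (fun as => E.val (fun k => (w k).val σ.values as) (σ D y).value) := rfl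
    -- If Σ is constant, the old subtree and the new leaf have the same abstraction.
    rcases E.constant_or_projection (σ D y) with ⟨e, he⟩ | ⟨k, hk⟩
    · rw [hleaf, houter]
      simp only [he]
    -- If Σ projects on hole `k`, the two sides are F[F[wₖ]] and F[wₖ]. They are equal when F is
    -- constant; otherwise F returns the value of the new leaf, which is F[wₖ].
    · rcases Q.constant_or_curry_const with ⟨e, he⟩ | hid
      · rw [he, he]
      · rw [hleaf, hid, houter, hk, hrv]
        simp only [hk]
        exact (hQ (w k)).symm

end TreeArgs

/-! ### Cellular forms of normal forms -/

/-- Agreement suffices because each argument is the value of a closed term, `T.absTm σ []`. -/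
theorem TreeArgs.val_congr {Δ : List Ty} {A : Ty} (Ts : TreeArgs C Δ A) (σ : Sub C Δ [])
    {f g : A.Den C} (h : Agree f g) : Ts.val σ.values f = Ts.val σ.values g := by
  induction Ts with
  | nil => exact h
  | cons T Ts ih =>
    refine ih ?_
    have := h (T.absTm σ [])
    rwa [Tm.value, T.eval_absTm] at this

/-- Neutral terms are treated together with an arbitrary list of pending arguments, so that the head
variable receives its whole spine at once. -/
theorem Normal.exists_cellularBody {k : Bool} {Γ : List Ty} {A : Ty} {n : Tm C Γ A}
    (h : Normal k n) :
    (k = false → ∃ s : Tm C (A.ctx Γ) Ty.ground, CellularBody s ∧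
      ∀ σ : Sub C Γ [], Agree (n.eval σ.values) ((Tm.lams A s).eval σ.values)) ∧
    (k = true → ∀ Ts : TreeArgs C Γ A, ∃ s : Tm C Γ Ty.ground, CellularBody s ∧
      ∀ σ : Sub C Γ [], s.eval σ.values = Ts.val σ.values (n.eval σ.values)) := by
  induction h with
  | var x => exact ⟨nofun, fun _ Ts => Ts.exists_cellularBody x⟩
  | @app Γ A B f a _ _ ihf iha =>
    refine ⟨nofun, fun _ Ts => ?_⟩
    obtain ⟨u, hu, hau⟩ := iha.1 rfl
    obtain ⟨T, hT⟩ := hu.exists_cellTree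
    obtain ⟨s, hs, hsv⟩ := ihf.2 rfl (.cons T Ts)
    refine ⟨s, hs, fun σ => ?_⟩
    have hTu : T.abs σ.values = (Tm.lams A u).eval σ.values := by
      simp only [Tm.eval_lams, CellTree.abs, hT]
    -- The argument only agrees with its cellular form, so the exchange goes through the closed
    -- function `f.subst σ`.
    have hagree := hau σ
    rw [← Tm.value_subst, ← Tm.value_subst] at hagree
    have := Agree.app_congr (f.subst σ) hagree
    rw [Tm.value_subst, Tm.value_subst, Tm.value_subst] at this
    rw [hsv, TreeArgs.val, hTu]
    exact (Ts.val_congr σ this).symm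
  | neutral _ ih =>
    refine ⟨fun _ => ?_, nofun⟩
    obtain ⟨s, hs, hsv⟩ := ih.2 rfl .nil
    exact ⟨s, hs, fun σ => (hsv σ).symm⟩
  | const c => exact ⟨fun _ => ⟨_, .const c, fun _ => rfl⟩, nofun⟩
  | lam _ ih =>
    refine ⟨fun _ => ?_, nofun⟩
    obtain ⟨s, hs, hsv⟩ := ih.1 rfl
    refine ⟨s, hs, fun σ a => ?_⟩
    have := hsv (Sub.cons a σ)
    rwa [Sub.values_cons] at this

end STLC

/-- Every closed term is observationally equivalent to a cellular term. -/
theorem mainTheorem1 {C : Type*} [Finite C] (A : STLC.Ty) (t : STLC.Closed C A)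
    (ht : t.EtaLong) :
    ∃ s : STLC.Closed C A, s.EtaLong ∧ STLC.Cellular s ∧ STLC.ObsEq t s := by
  obtain ⟨n, hn, hnt⟩ := t.exists_normal
  obtain ⟨s, hs, hns⟩ := hn.exists_cellularBody.1 rfl
  refine ⟨STLC.Tm.lams A s, hs.etaLong.lams A, STLC.CellularUnder.lams A hs,
    STLC.obsEq_of_agree ?_⟩
  have := hns (fun _ x => STLC.Tm.var x)
  rwa [STLC.Env.eq_nil (STLC.Sub.values _), hnt] at this
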